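/- **Theorem 5.** Let $\mathcal{H}$ be a real or complex Hilbert space and $\mathcal{A}$ a densely defined, possibly unbounded, self-adjoint operator on $\mathcal{H}$. Let $k\ge 2$ and let $q_1,\dots,q_k$ be orthonormal vectors in the domain of $\mathcal{A}$, spanning $Q$. Let $A_1=(\langle q_i,\mathcal{A}q_j\rangle)_{i,j=1}^k=\Omega\,\mathrm{diag}(\widehat\lambda_1,\dots,\widehat\lambda_k)\,\Omega^*$ with $\Omega$ unitary, and let $[\widehat u_1,\dots,\widehat u_k]=[q_1,\dots,q_k]\Omega$ be the Ritz vectors. Select one of them; number the Ritz pairs so that it is $\widehat u=\widehat u_1$. Put $Q_1=\mathrm{span}(\widehat u_1)$, $Q_2=\mathrm{span}(\widehat u_2,\dots,\widehat u_k)$, $Q_3=Q^\perp$, let $\mathcal{P}_i$ be the orthogonal projector onto $Q_i$, $\mathcal{P}_{2,i}$ the orthogonal projector onto $\mathrm{span}(\widehat u_i)$, and $\mathcal{A}_{ij}=\mathcal{P}_i\mathcal{A}\mathcal{P}_j$. In terms of operator norms, set $$\|R\|=\|\mathcal{A}_{31}+\mathcal{A}_{32}\|,\quad \|R_1\|=\|\mathcal{A}_{31}\|,\quad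 \|R_2\|=\|\mathcal{A}_{32}\|,\quad \|r_i\|=\|\mathcal{A}_{32}\mathcal{P}_{2,i}\|\ \ (i=2,\dots,k).$$ Let $\mathcal{A}u=\lambda u$ with $u\neq 0$, and let ${\rm gap}=\mathrm{dist}(\lambda,\lambda(\mathcal{A}_{22}))$ and ${\rm Gap}=\mathrm{dist}(\lambda,\lambda(\mathcal{A}_{33}))$, where $\lambda(\mathcal{A}_{ii})$ is the spectrum of the restriction of $\mathcal{A}_{ii}$ to $Q_i$ (assume $Q_3\ne\{0\}$, so that this spectrum is non-empty). Here $\angle(u,\widehat u)\in[0,\pi/2]$ is the angle between the lines spanned by $u$ and $\widehat u$. (a) If ${\rm gap}>0$ and ${\rm Gap}>0$, then $$\sin\angle(u,\widehat u)\le \frac{\|R\|}{{\rm Gap}}\sqrt{1+\frac{\|R_2\|^2}{{\rm gap}^2}}\quad\left(\le\frac{\|R\|}{{\rm Gap}}\Big(1+\frac{\|R_2\|}{{\rm gap}}\Big)\right).$$ (b) If ${\rm gap}>0$ and ${\rm Gap}>\frac{\|R_2\|^2}{{\rm gap}}$, then $$\sin\angle(u,\widehat u)\le \frac{\|R_1\|}{{\rm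 Gap}-\frac{\|R_2\|^2}{{\rm gap}}}\sqrt{1+\frac{\|R_2\|^2}{{\rm gap}^2}}.$$ (c) If $\lambda\ne\widehat\lambda_i$ for $i=2,\dots,k$ and ${\rm Gap}>\sum_{i=2}^k\frac{\|r_i\|^2}{|\lambda-\widehat\lambda_i|}$, then $$\sin\angle(u,\widehat u)\le\frac{\|R_1\|}{{\rm Gap}-\sum_{i=2}^k\frac{\|r_i\|^2}{|\lambda-\widehat\lambda_i|}}\sqrt{1+\Big(\sum_{i=2}^k\frac{\|r_i\|}{|\lambda-\widehat\lambda_i|}\Big)^2}.$$ -/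

import Mathlib

namespace RitzHilbert

noncomputable section

variable {𝕜 : Type*} [RCLike 𝕜]
variable {E : Type*} [NormedAddCommGroup E] [InnerProductSpace 𝕜 E]

/-! ### Partially defined (possibly unbounded) operators -/

/-- The operator norm of a partially defined linear operator: the least `c ≥ 0` such that
`‖T x‖ ≤ c ‖x‖` for all `x` in the domain of `T`. It is meaningful for bounded `T`; all the operators
to which it is applied below have finite rank. -/
def opNorm (T : E →ₗ.[𝕜] E) : ℝ :=
  sInf {c : ℝ | 0 ≤ c ∧ ∀ x : T.domain, ‖T x‖ ≤ c * ‖(x : E)‖}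

/-- The resolvent set of a partially defined operator `T`: those `z` for which
`T - z : dom T → E` is a bijection whose inverse `R` is a bounded operator on `E`. -/
def resolventSet (T : E →ₗ.[𝕜] E) : Set 𝕜 :=
  {z | ∃ R : E →L[𝕜] E,
    (∀ y : E, ∃ h : R y ∈ T.domain, T ⟨R y, h⟩ - z • R y = y) ∧
    ∀ x : T.domain, R (T x - z • (x : E)) = x}

/-- The spectrum of a partially defined operator. -/
def spec (T : E →ₗ.[𝕜] E) : Set 𝕜 := (resolventSet T)ᶜ

/-- The composition `T L` of a partially defined operator `T` with a bounded operator `L`, with its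
natural domain `{x | L x ∈ dom T}`. -/
def precomp (T : E →ₗ.[𝕜] E) (L : E →L[𝕜] E) : E →ₗ.[𝕜] E where
  domain := T.domain.comap (L : E →ₗ[𝕜] E)
  toFun := T.toFun ∘ₗ (L : E →ₗ[𝕜] E).restrict (fun _ hx => hx)

/-- The composition `L T` of a bounded operator `L` with a partially defined operator `T`. -/
def postcomp (L : E →L[𝕜] E) (T : E →ₗ.[𝕜] E) : E →ₗ.[𝕜] E where
  domain := T.domain
  toFun := (L : E →ₗ[𝕜] E) ∘ₗ T.toFun

/-- The block `P_U A P_V`, where `P_U`, `P_V` are the orthogonal projectors onto `U`, `V`. -/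
def block (A : E →ₗ.[𝕜] E) (U V : Submodule 𝕜 E)
    [U.HasOrthogonalProjection] [V.HasOrthogonalProjection] : E →ₗ.[𝕜] E :=
  postcomp U.starProjection (precomp A V.starProjection)

/-- The restriction of `P_U A P_U` to `U`, as an operator on the space `U` with domain
`U ∩ dom A`. -/
def compression (A : E →ₗ.[𝕜] E) (U : Submodule 𝕜 E) [U.HasOrthogonalProjection] :
    U →ₗ.[𝕜] U where
  domain := A.domain.comap U.subtype
  toFun := (U.orthogonalProjectionOnto : E →ₗ[𝕜] U) ∘ₗ A.toFun ∘ₗ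
    U.subtype.restrict (fun _ hx => hx)

/-- `P_U A P_U` agrees on `U ∩ dom A` with the compression of `A` to `U`. -/
theorem block_self_eq_compression (A : E →ₗ.[𝕜] E) (U : Submodule 𝕜 E)
    [U.HasOrthogonalProjection] (x : (compression A U).domain)
    (y : (block A U U).domain) (h : (y : E) = ((x : U) : E)) :
    block A U U y = (compression A U x : U) := by
  have key : (⟨U.starProjection (y : E), y.2⟩ : A.domain) = ⟨((x : U) : E), x.2⟩ := by
    apply Subtype.ext
    change U.starProjection (y : E) = ((x : U) : E)
    rw [h]
    exact Submodule.starProjection_eq_self_iff.mpr (x : U).2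
  change U.starProjection (A ⟨U.starProjection (y : E), y.2⟩) =
    ((U.orthogonalProjectionOnto (A ⟨((x : U) : E), x.2⟩) : U) : E)
  rw [key]
  rfl

/-- The (acute) angle between the lines spanned by two nonzero vectors. -/
def lineAngle (𝕜 : Type*) [RCLike 𝕜] {E : Type*} [NormedAddCommGroup E] [InnerProductSpace 𝕜 E]
    (x y : E) : ℝ :=
  Real.arccos (‖inner 𝕜 x y‖ / (‖x‖ * ‖y‖))

instance hasOrthogonalProjection_span_range {ι : Type*} [Finite ι] (x : ι → E) :
    (Submodule.span 𝕜 (Set.range x)).HasOrthogonalProjection :=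
  haveI : FiniteDimensional 𝕜 (Submodule.span 𝕜 (Set.range x)) :=
    FiniteDimensional.span_of_finite 𝕜 (Set.finite_range x)
  inferInstance

/-! ### The Rayleigh–Ritz process -/

variable {k : ℕ}

/-- The matrix with entries `⟨q_i, A q_j⟩`, for `q_1, …, q_k` in the domain of `A`. -/
def ritzMatrix (A : E →ₗ.[𝕜] E) (q : Fin k → A.domain) : Matrix (Fin k) (Fin k) 𝕜 :=
  Matrix.of fun i j => inner 𝕜 (q i : E) (A (q j))

/-- The `j`-th Ritz vector, that is, the `j`-th entry of `[q_1, …, q_k] Ω`. -/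
def ritzVector (q : Fin k → E) (Ω : Matrix (Fin k) (Fin k) 𝕜) (j : Fin k) : E :=
  ∑ i, Ω i j • q i

/-- The data produced by the Rayleigh–Ritz process for `A` on the trial space with orthonormal basis
`q`: an eigenvalue decomposition `Ω diag(μ) Ω*`, with `Ω` unitary, of the Ritz matrix. -/
structure IsRayleighRitz (A : E →ₗ.[𝕜] E) (q : Fin k → A.domain)
    (Ω : Matrix (Fin k) (Fin k) 𝕜) (μ : Fin k → 𝕜) : Prop where
  orthonormal : Orthonormal 𝕜 (fun i => (q i : E))
  unitary : Ω ∈ Matrix.unitaryGroup (Fin k) 𝕜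
  decomposition : ritzMatrix A q = Ω * Matrix.diagonal μ * Ω.conjTranspose

/-- `Q₁`: the line spanned by the selected Ritz vector. -/
abbrev Q₁ (x : Fin k → E) (i : Fin k) : Submodule 𝕜 E := Submodule.span 𝕜 {x i}

/-- `Q₂`: the span of the other Ritz vectors. -/
abbrev Q₂ (x : Fin k → E) (i : Fin k) : Submodule 𝕜 E :=
  Submodule.span 𝕜 (Set.range fun j : {j : Fin k // j ≠ i} => x j)

/-- `Q₃`: the orthogonal complement of the trial space spanned by `q`. -/
abbrev Q₃ (q : Fin k → E) : Submodule 𝕜 E := (Submodule.span 𝕜 (Set.range q))ᗮ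

section Quantities

variable (A : E →ₗ.[𝕜] E) (q : Fin k → E) (Ω : Matrix (Fin k) (Fin k) 𝕜) (i : Fin k)

/-- `‖R‖ = ‖A₃₁ + A₃₂‖`. -/
def normR : ℝ :=
  opNorm (block A (Q₃ q) (Q₁ (𝕜 := 𝕜) (ritzVector q Ω) i) +
    block A (Q₃ q) (Q₂ (𝕜 := 𝕜) (ritzVector q Ω) i))

/-- `‖R₁‖ = ‖A₃₁‖`. -/
def normR₁ : ℝ := opNorm (block A (Q₃ q) (Q₁ (𝕜 := 𝕜) (ritzVector q Ω) i))

/-- `‖R₂‖ = ‖A₃₂‖`. -/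
def normR₂ : ℝ := opNorm (block A (Q₃ q) (Q₂ (𝕜 := 𝕜) (ritzVector q Ω) i))

/-- `‖r_j‖ = ‖A₃₂ P_{2,j}‖` for `j ≠ i`, with `P_{2,j}` the orthogonal projector onto the line
spanned by the `j`-th Ritz vector. -/
def normr (j : Fin k) : ℝ :=
  opNorm (precomp (block A (Q₃ q) (Q₂ (𝕜 := 𝕜) (ritzVector q Ω) i))
    (Submodule.span 𝕜 {ritzVector q Ω j}).starProjection)

/-- `gap`: the distance of `z` from the spectrum of `A₂₂` restricted to `Q₂`. -/
def smallGap (z : 𝕜) : ℝ :=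
  Metric.infDist z (spec (compression A (Q₂ (𝕜 := 𝕜) (ritzVector q Ω) i)))

/-- `Gap`: the distance of `z` from the spectrum of `A₃₃` restricted to `Q₃`. -/
def bigGap (z : 𝕜) : ℝ :=
  Metric.infDist z (spec (compression A (Q₃ q)))

end Quantities

end

end RitzHilbert

/-! Split `u = u₁ + u₂ + w` along `Q₁`, `Q₂`, `Q₃`. Inside the trial space `A` is diagonal in the
Ritz vectors `x_j`, so the eigenvalue equation projected there decouples: `(lam - μ j) * c j = ⟪P₃ A
x_j, w⟫` for each coefficient `c j`. Projected to `Q₃` it reads `A₃₃ w - lam w = -(P₃ A u₁ + P₃ A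
u₂)`.

The first relation controls `u₂` by `w`, with factor `R₂ / gap` (`norm_Q₂_component_le`) or
coefficient by coefficient (`norm_coeff_le`). The second gives `Gap * ‖w‖ ≤ ‖P₃ A u₁ + P₃ A u₂‖`.
For (a) the right side is at most `R * ‖u‖`. For (b) and (c) it is split: the first term is at most
`R₁ * ‖u‖`, the second is a multiple of `‖w‖` and is absorbed on the left. The sine is `√(‖u₂‖² +
‖w‖²) / ‖u‖`.

The analytic input is `infDist_spec_mul_norm_le`, which must cover an unbounded `A₃₃`. The resolvent
`R` at a real point `z` is bounded and symmetric, so if `R ≠ 0`, one of `±‖R‖` is an approximate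
eigenvalue of `R`. Then `z + ‖R‖⁻¹` or `z - ‖R‖⁻¹` is in the spectrum, whence the distance is at
most `‖R‖⁻¹`. -/

namespace RitzHilbert

/-! ### Norms of finite-rank blocks -/

section OperatorNorm

variable {𝕜 : Type*} [RCLike 𝕜]
variable {E : Type*} [NormedAddCommGroup E] [InnerProductSpace 𝕜 E]

theorem opNorm_nonneg (T : E →ₗ.[𝕜] E) : 0 ≤ opNorm T :=
  Real.sInf_nonneg fun _ hc => hc.1

/-- Some bound has to be supplied, since the infimum of the empty set is `0`. Its sign does not
matter. -/
theorem norm_apply_le_opNorm {T : E →ₗ.[𝕜] E} {C : ℝ}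
    (hC : ∀ x : T.domain, ‖T x‖ ≤ C * ‖(x : E)‖) (x : T.domain) :
    ‖T x‖ ≤ opNorm T * ‖(x : E)‖ := by
  by_cases hx : (x : E) = 0
  · have hx' : x = 0 := Subtype.ext hx
    simp [hx']
  have hpos : 0 < ‖(x : E)‖ := norm_pos_iff.mpr hx
  rw [← div_le_iff₀ hpos]
  refine le_csInf ⟨max C 0, le_max_right _ _, fun y => (hC y).trans ?_⟩ fun c hc => ?_
  · exact mul_le_mul_of_nonneg_right (le_max_left _ _) (norm_nonneg _)
  · rw [div_le_iff₀ hpos]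
    exact hc.2 x

variable (A : E →ₗ.[𝕜] E) (U V W : Submodule 𝕜 E) [U.HasOrthogonalProjection]
  [V.HasOrthogonalProjection] [W.HasOrthogonalProjection]

/-- An operator is bounded on every finite-dimensional subspace of its domain. -/
theorem exists_bound_block [FiniteDimensional 𝕜 V] (hV : V ≤ A.domain) :
    ∃ C : ℝ, 0 ≤ C ∧ ∀ x : (block A U V).domain, ‖block A U V x‖ ≤ C * ‖(x : E)‖ := by
  let f : V →L[𝕜] E := LinearMap.toContinuousLinearMap (A.toFun ∘ₗ Submodule.inclusion hV)
  refine ⟨‖f‖, norm_nonneg _, fun x => ?_⟩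
  have h1 : block A U V x = U.starProjection (f (V.orthogonalProjectionOnto x)) := rfl
  rw [h1]
  calc _ ≤ ‖f (V.orthogonalProjectionOnto x)‖ := U.norm_starProjection_apply_le _
    _ ≤ ‖f‖ * ‖V.orthogonalProjectionOnto (x : E)‖ := f.le_opNorm _
    _ ≤ _ := by
      gcongr
      exact V.norm_starProjection_apply_le (x : E)

theorem apply_starProjection_of_mem {x : A.domain} (hx : (x : E) ∈ V)
    (h : V.starProjection (x : E) ∈ A.domain) : A ⟨V.starProjection (x : E), h⟩ = A x := by
  congr 1
  exact Subtype.ext (Submodule.starProjection_eq_self_iff.mpr hx)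

theorem norm_starProjection_apply_le_opNorm_block [FiniteDimensional 𝕜 V] (hV : V ≤ A.domain)
    (x : A.domain) (hx : (x : E) ∈ V) :
    ‖U.starProjection (A x)‖ ≤ opNorm (block A U V) * ‖(x : E)‖ := by
  obtain ⟨C, -, hC⟩ := exists_bound_block A U V hV
  have hP : V.starProjection (x : E) ∈ A.domain := hV (V.starProjection_apply_mem _)
  have := norm_apply_le_opNorm hC ⟨x, hP⟩
  rwa [show block A U V ⟨x, hP⟩ = U.starProjection (A x) from
    congrArg U.starProjection (apply_starProjection_of_mem A V hx hP)] at this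

/-- With `W` the line of a Ritz vector, this extracts from `normr` the estimate needed in (c). -/
theorem norm_starProjection_apply_le_opNorm_precomp [FiniteDimensional 𝕜 V] (hV : V ≤ A.domain)
    (x : A.domain) (hx : (x : E) ∈ V) (hxW : (x : E) ∈ W) :
    ‖U.starProjection (A x)‖ ≤
      opNorm (precomp (block A U V) W.starProjection) * ‖(x : E)‖ := by
  obtain ⟨C, hC0, hC⟩ := exists_bound_block A U V hV
  have hb : ∀ y : (precomp (block A U V) W.starProjection).domain,
      ‖precomp (block A U V) W.starProjection y‖ ≤ C * ‖(y : E)‖ := fun y =>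
    (hC ⟨W.starProjection y, y.2⟩).trans
      (mul_le_mul_of_nonneg_left (W.norm_starProjection_apply_le _) hC0)
  have hP : V.starProjection (W.starProjection (x : E)) ∈ A.domain :=
    hV (V.starProjection_apply_mem _)
  have := norm_apply_le_opNorm hb ⟨x, hP⟩
  have hval : precomp (block A U V) W.starProjection ⟨x, hP⟩ = U.starProjection (A x) := by
    change U.starProjection (A ⟨V.starProjection (W.starProjection (x : E)), hP⟩) = _
    congr 2
    apply Subtype.ext
    change V.starProjection (W.starProjection (x : E)) = x
    rw [Submodule.starProjection_eq_self_iff.mpr hxW, Submodule.starProjection_eq_self_iff.mpr hx]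
  rwa [hval] at this

/-- Orthogonality lets the two projectors recover `x` and `y` from `x + y`. -/
theorem norm_starProjection_apply_add_le_opNorm_block_add [FiniteDimensional 𝕜 V]
    [FiniteDimensional 𝕜 W] (hV : V ≤ A.domain) (hW : W ≤ A.domain) (hVW : V ⟂ W)
    (x y : A.domain) (hx : (x : E) ∈ V) (hy : (y : E) ∈ W) :
    ‖U.starProjection (A x) + U.starProjection (A y)‖ ≤
      opNorm (block A U V + block A U W) * ‖(x : E) + y‖ := by
  obtain ⟨C, -, hC⟩ := exists_bound_block A U V hV
  obtain ⟨D, -, hD⟩ := exists_bound_block A U W hW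
  have hb : ∀ z : (block A U V + block A U W).domain,
      ‖(block A U V + block A U W) z‖ ≤ (C + D) * ‖(z : E)‖ := fun z => by
    rw [add_mul]
    exact (norm_add_le _ _).trans (add_le_add (hC ⟨z, z.2.1⟩) (hD ⟨z, z.2.2⟩))
  have hPV : V.starProjection ((x : E) + y) = x := by
    rw [map_add, Submodule.starProjection_eq_self_iff.mpr hx,
      (V.starProjection_apply_eq_zero_iff).mpr (hVW.symm.le hy), add_zero]
  have hPW : W.starProjection ((x : E) + y) = y := by
    rw [map_add, Submodule.starProjection_eq_self_iff.mpr hy,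
      (W.starProjection_apply_eq_zero_iff).mpr (hVW.le hx), zero_add]
  have hV' : V.starProjection ((x : E) + y) ∈ A.domain := hV (V.starProjection_apply_mem _)
  have hW' : W.starProjection ((x : E) + y) ∈ A.domain := hW (W.starProjection_apply_mem _)
  have := norm_apply_le_opNorm hb ⟨(x : E) + y, hV', hW'⟩
  have hval : (block A U V + block A U W) ⟨(x : E) + y, hV', hW'⟩ =
      U.starProjection (A x) + U.starProjection (A y) := by
    change U.starProjection (A ⟨V.starProjection ((x : E) + y), hV'⟩) +
      U.starProjection (A ⟨W.starProjection ((x : E) + y), hW'⟩) = _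
    congr 3 <;> exact Subtype.ext ‹_›
  rwa [hval] at this

end OperatorNorm

/-! ### Resolvent estimate for symmetric operators -/

section Resolvent

variable {𝕜 : Type*} [RCLike 𝕜]
variable {E : Type*} [NormedAddCommGroup E] [InnerProductSpace 𝕜 E]

open scoped InnerProductSpace

/-- One of `±‖R‖` lies in the approximate point spectrum of a bounded symmetric operator `R`. -/
theorem not_bounded_below_of_symmetric {R : E →L[𝕜] E} (hR : R ≠ 0)
    (hsymm : ∀ x y, ⟪R x, y⟫_𝕜 = ⟪x, R y⟫_𝕜) {C D : ℝ} (hC : 0 ≤ C)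
    (h1 : ∀ x, ‖x‖ ≤ C * ‖R x - (‖R‖ : 𝕜) • x‖)
    (h2 : ∀ x, ‖x‖ ≤ D * ‖R x + (‖R‖ : 𝕜) • x‖) : False := by
  set M := ‖R‖ with hM
  have hM0 : 0 < M := norm_pos_iff.mpr hR
  set B := max D 1
  have hB : 0 < B := lt_max_of_lt_right one_pos
  set C' := C + 1
  have hC' : 0 < C' := by positivity
  -- The two lower bounds compose to one for `R² - M²`. Expanding its square and using `‖R (R x)‖ ≤
  -- M * ‖R x‖` bounds it above by a multiple of the defect `M² ‖x‖² - ‖R x‖²`.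
  have key : ∀ x, ‖x‖ ^ 2 ≤ (C' * B) ^ 2 * (M ^ 2 * (M ^ 2 * ‖x‖ ^ 2 - ‖R x‖ ^ 2)) := fun x => by
    have e1 : ‖x‖ ≤ C' * B * ‖R (R x) - ((M ^ 2 : ℝ) : 𝕜) • x‖ := by
      have a1 : ‖x‖ ≤ C' * ‖R x - (M : 𝕜) • x‖ := (h1 x).trans (by gcongr; simp [C'])
      have a2 := (h2 (R x - (M : 𝕜) • x)).trans
        (mul_le_mul_of_nonneg_right (le_max_left D 1) (norm_nonneg _))
      have a3 : R (R x - (M : 𝕜) • x) + (M : 𝕜) • (R x - (M : 𝕜) • x) =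
          R (R x) - ((M ^ 2 : ℝ) : 𝕜) • x := by
        rw [map_sub, map_smul]
        push_cast
        module
      rw [a3] at a2
      calc ‖x‖ ≤ C' * ‖R x - (M : 𝕜) • x‖ := a1
        _ ≤ C' * (B * ‖R (R x) - ((M ^ 2 : ℝ) : 𝕜) • x‖) := by gcongr
        _ = _ := by ring
    have e2 : ‖R (R x) - ((M ^ 2 : ℝ) : 𝕜) • x‖ ^ 2 ≤ M ^ 2 * (M ^ 2 * ‖x‖ ^ 2 - ‖R x‖ ^ 2) := by
      rw [@norm_sub_sq 𝕜, inner_smul_right, hsymm, norm_smul, RCLike.norm_ofReal,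
        RCLike.re_ofReal_mul, inner_self_eq_norm_sq, abs_of_nonneg (sq_nonneg M)]
      have := R.le_opNorm (R x)
      have := mul_self_le_mul_self (norm_nonneg _) this
      rw [← hM] at this
      nlinarith
    calc ‖x‖ ^ 2 ≤ (C' * B * ‖R (R x) - ((M ^ 2 : ℝ) : 𝕜) • x‖) ^ 2 := by gcongr
      _ = (C' * B) ^ 2 * ‖R (R x) - ((M ^ 2 : ℝ) : 𝕜) • x‖ ^ 2 := by ring
      _ ≤ _ := by gcongr
  -- So the defect is at least a fixed multiple of `‖x‖²`, that is `‖R x‖² ≤ K * ‖x‖²` with `K <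
  -- M²`, contradicting `M = ‖R‖`.
  set K := M ^ 2 - 1 / ((C' * B) ^ 2 * M ^ 2) with hK
  have hle : M ≤ √K := R.opNorm_le_bound (Real.sqrt_nonneg _) fun x => by
    rw [← Real.sqrt_sq (norm_nonneg (R x)), ← Real.sqrt_sq (norm_nonneg x),
      ← Real.sqrt_mul' _ (sq_nonneg _)]
    apply Real.sqrt_le_sqrt
    have hp : 0 < (C' * B) ^ 2 * M ^ 2 := by positivity
    have := key x
    have h3 : ‖x‖ ^ 2 / ((C' * B) ^ 2 * M ^ 2) ≤ M ^ 2 * ‖x‖ ^ 2 - ‖R x‖ ^ 2 := by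
      rw [div_le_iff₀ hp]
      linarith
    rw [hK, sub_mul, one_div_mul_eq_div]
    linarith
  rw [Real.le_sqrt' hM0, hK] at hle
  have : 0 < 1 / ((C' * B) ^ 2 * M ^ 2) := by positivity
  linarith

/-- If `R = (T - z)⁻¹` and `z + ν⁻¹` is in the resolvent set of `T`, then `R - ν` is bounded
below. -/
theorem exists_bound_of_add_inv_mem_resolventSet {T : E →ₗ.[𝕜] E} {z ν : 𝕜} (hν : ν ≠ 0)
    {R : E →L[𝕜] E} (hR : ∀ y : E, ∃ h : R y ∈ T.domain, T ⟨R y, h⟩ - z • R y = y)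
    (hz : z + ν⁻¹ ∈ resolventSet T) :
    ∃ C : ℝ, 0 ≤ C ∧ ∀ x, ‖x‖ ≤ C * ‖R x - ν • x‖ := by
  obtain ⟨S, -, hS⟩ := hz
  have hν' : 0 < ‖ν‖ := norm_pos_iff.mpr hν
  refine ⟨(‖S‖ / ‖ν‖ + 1) / ‖ν‖, by positivity, fun x => ?_⟩
  obtain ⟨h, hx⟩ := hR x
  -- Because `R - ν = -ν (T - (z + ν⁻¹)) R`, the inverse `S` bounds `R x` by `R x - ν x`, and then
  -- `ν x` is a difference of two controlled vectors.
  have h1 : S (R x - ν • x) = -(ν • R x) := by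
    have e : R x - ν • x = -(ν • (T ⟨R x, h⟩ - (z + ν⁻¹) • R x)) := by
      have : (T ⟨R x, h⟩ - (z + ν⁻¹) • R x) = x - ν⁻¹ • R x := by
        rw [eq_add_of_sub_eq hx, add_smul]
        abel
      rw [this, smul_sub, smul_inv_smul₀ hν]
      abel
    rw [e, map_neg, map_smul, hS ⟨R x, h⟩]
  have h2 : ‖R x‖ ≤ ‖S‖ / ‖ν‖ * ‖R x - ν • x‖ := by
    have := S.le_opNorm (R x - ν • x)
    rw [h1, norm_neg, norm_smul] at this
    rw [div_mul_eq_mul_div, le_div_iff₀ hν']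
    linarith
  have h3 : ‖ν‖ * ‖x‖ ≤ ‖R x‖ + ‖R x - ν • x‖ := by
    rw [← norm_smul]
    have := norm_sub_le (R x) (R x - ν • x)
    rwa [sub_sub_cancel] at this
  rw [div_mul_eq_mul_div, le_div_iff₀ hν']
  linarith

/-- The resolvent estimate `dist(z, σ(T)) ‖x‖ ≤ ‖(T - z) x‖` for symmetric `T` and real `z`. -/
theorem infDist_spec_mul_norm_le {T : E →ₗ.[𝕜] E}
    (hT : ∀ x y : T.domain, ⟪T x, (y : E)⟫_𝕜 = ⟪(x : E), T y⟫_𝕜) {z : 𝕜}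
    (hz : (starRingEnd 𝕜) z = z) (x : T.domain) :
    Metric.infDist z (spec T) * ‖(x : E)‖ ≤ ‖T x - z • (x : E)‖ := by
  -- The zero case also absorbs an empty spectrum, where `Metric.infDist` is `0` by convention.
  rcases (Metric.infDist_nonneg (x := z) (s := spec T)).eq_or_lt with h0 | hpos
  · rw [← h0, zero_mul]
    exact norm_nonneg _
  have hzr : z ∈ resolventSet T := by
    by_contra h
    exact hpos.ne' (Metric.infDist_zero_of_mem h)
  obtain ⟨R, hR, hR'⟩ := hzr
  by_cases hR0 : R = 0
  · have := hR' x
    rw [hR0] at this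
    rw [← this]
    simp
  have hsymm : ∀ x y, ⟪R x, y⟫_𝕜 = ⟪x, R y⟫_𝕜 := fun x y => by
    obtain ⟨hx, hx'⟩ := hR x
    obtain ⟨hy, hy'⟩ := hR y
    conv_lhs => rw [← hy']
    conv_rhs => rw [← hx']
    rw [inner_sub_left, inner_sub_right, inner_smul_left, inner_smul_right, hz]
    rw [← hT ⟨R x, hx⟩ ⟨R y, hy⟩]
  have hM0 : 0 < ‖R‖ := norm_pos_iff.mpr hR0
  have hMk : (‖R‖ : 𝕜) ≠ 0 := RCLike.ofReal_ne_zero.mpr hM0.ne'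
  have far : ∀ ν : 𝕜, ‖ν‖ = ‖R‖ → z + ν⁻¹ ∈ spec T → Metric.infDist z (spec T) ≤ ‖R‖⁻¹ :=
    fun ν hν h => by
      have := Metric.infDist_le_dist_of_mem (x := z) h
      rwa [dist_self_add_right, norm_inv, hν] at this
  have hle : Metric.infDist z (spec T) ≤ ‖R‖⁻¹ := by
    by_cases h1 : z + (‖R‖ : 𝕜)⁻¹ ∈ spec T
    · exact far _ (by simp) h1
    by_cases h2 : z + (-(‖R‖ : 𝕜))⁻¹ ∈ spec T
    · exact far _ (by simp) h2
    obtain ⟨C, hC, hC'⟩ := exists_bound_of_add_inv_mem_resolventSet hMk hR (not_not.mp h1)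
    obtain ⟨D, -, hD'⟩ :=
      exists_bound_of_add_inv_mem_resolventSet (neg_ne_zero.mpr hMk) hR (not_not.mp h2)
    refine (not_bounded_below_of_symmetric hR0 (D := D) hsymm hC hC' fun x => ?_).elim
    simpa using hD' x
  calc _ ≤ ‖R‖⁻¹ * (‖R‖ * ‖T x - z • (x : E)‖) := by
        gcongr
        have := R.le_opNorm (T x - z • (x : E))
        rwa [hR' x] at this
    _ = _ := by field_simp

theorem mem_spec_of_apply_eq_smul {T : E →ₗ.[𝕜] E} {z : 𝕜} {x : T.domain} (hx : (x : E) ≠ 0)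
    (h : T x = z • (x : E)) : z ∈ spec T := by
  rintro ⟨R, -, hR⟩
  apply hx
  rw [← hR x, h, sub_self, map_zero]

/-- Compressions of symmetric operators are symmetric. -/
theorem compression_symmetric {A : E →ₗ.[𝕜] E}
    (hA : ∀ x y : A.domain, ⟪A x, (y : E)⟫_𝕜 = ⟪(x : E), A y⟫_𝕜) (U : Submodule 𝕜 E)
    [U.HasOrthogonalProjection] (x y : (compression A U).domain) :
    ⟪compression A U x, (y : U)⟫_𝕜 = ⟪(x : U), compression A U y⟫_𝕜 := by
  change ⟪U.orthogonalProjectionOnto (A ⟨((x : U) : E), x.2⟩), (y : U)⟫_𝕜 =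
    ⟪(x : U), U.orthogonalProjectionOnto (A ⟨((y : U) : E), y.2⟩)⟫_𝕜
  rw [Submodule.inner_orthogonalProjectionOnto_eq_of_mem_right,
    Submodule.inner_orthogonalProjectionOnto_eq_of_mem_left]
  exact hA ⟨((x : U) : E), x.2⟩ ⟨((y : U) : E), y.2⟩

end Resolvent

end RitzHilbert
namespace RitzHilbert

/-! ### Ritz vectors and the block eigenvalue equation -/

section Ritz

variable {𝕜 : Type*} [RCLike 𝕜]
variable {E : Type*} [NormedAddCommGroup E] [InnerProductSpace 𝕜 E]

open scoped InnerProductSpace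

theorem sin_lineAngle_of_norm_eq_one {x y : E} (hx : x ≠ 0) (hy : ‖y‖ = 1) {d : ℝ} (hd : 0 ≤ d)
    (h : ‖x‖ ^ 2 = ‖⟪y, x⟫_𝕜‖ ^ 2 + d) : Real.sin (lineAngle 𝕜 x y) = √d / ‖x‖ := by
  have hx' : 0 < ‖x‖ := norm_pos_iff.mpr hx
  rw [lineAngle, Real.sin_arccos, hy, mul_one, norm_inner_symm, div_pow]
  rw [show 1 - ‖⟪y, x⟫_𝕜‖ ^ 2 / ‖x‖ ^ 2 = d / ‖x‖ ^ 2 by field_simp; linarith]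
  rw [Real.sqrt_div hd, Real.sqrt_sq hx'.le]

/-- The common last step of all three bounds, with `s = ‖w‖`, `t = ‖u₂‖`, `N = ‖u‖`. -/
theorem sqrt_add_sq_div_le {s t N a b : ℝ} (hs : 0 ≤ s) (ht : 0 ≤ t) (hN : 0 < N)
    (hsa : s ≤ a * N) (htb : t ≤ b * s) : √(t ^ 2 + s ^ 2) / N ≤ a * √(1 + b ^ 2) := by
  rw [div_le_iff₀ hN]
  calc √(t ^ 2 + s ^ 2) ≤ √(s ^ 2 * (1 + b ^ 2)) := by
        apply Real.sqrt_le_sqrt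
        have := pow_le_pow_left₀ ht htb 2
        nlinarith
    _ = s * √(1 + b ^ 2) := by rw [Real.sqrt_mul (sq_nonneg s), Real.sqrt_sq hs]
    _ ≤ a * N * √(1 + b ^ 2) := by gcongr
    _ = _ := by ring

theorem conj_eq_of_apply_eq_smul {A : E →ₗ.[𝕜] E}
    (hA : ∀ x y : A.domain, ⟪A x, (y : E)⟫_𝕜 = ⟪(x : E), A y⟫_𝕜) {lam : 𝕜} {u : A.domain}
    (hu : (u : E) ≠ 0) (hAu : A u = lam • (u : E)) : (starRingEnd 𝕜) lam = lam := by
  have := hA u u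
  rw [hAu, inner_smul_left, inner_smul_right] at this
  exact mul_right_cancel₀ (inner_self_ne_zero.mpr hu) this

theorem infDist_spec_compression_mul_norm_le {A : E →ₗ.[𝕜] E}
    (hA : ∀ x y : A.domain, ⟪A x, (y : E)⟫_𝕜 = ⟪(x : E), A y⟫_𝕜) (U : Submodule 𝕜 E)
    [U.HasOrthogonalProjection] {z : 𝕜} (hz : (starRingEnd 𝕜) z = z) {w : A.domain}
    (hw : (w : E) ∈ U) :
    Metric.infDist z (spec (compression A U)) * ‖(w : E)‖ ≤
      ‖U.starProjection (A w) - z • (w : E)‖ :=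
  infDist_spec_mul_norm_le (compression_symmetric hA U) hz
    (⟨⟨w, hw⟩, w.2⟩ : (compression A U).domain)

variable {k : ℕ} {A : E →ₗ.[𝕜] E} {X : Fin k → A.domain} {μ : Fin k → 𝕜}

theorem Q₁_le_domain (X : Fin k → A.domain) (i : Fin k) :
    Q₁ (𝕜 := 𝕜) (fun j => (X j : E)) i ≤ A.domain := by
  rw [Submodule.span_singleton_le_iff_mem]
  exact (X i).2

theorem Q₂_le_domain (X : Fin k → A.domain) (i : Fin k) :
    Q₂ (𝕜 := 𝕜) (fun j => (X j : E)) i ≤ A.domain := by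
  rw [Submodule.span_le]
  rintro _ ⟨j, rfl⟩
  exact (X j).2

theorem mem_Q₂ (x : Fin k → E) {i j : Fin k} (hj : j ≠ i) : x j ∈ Q₂ (𝕜 := 𝕜) x i :=
  Submodule.subset_span ⟨⟨j, hj⟩, rfl⟩

theorem sum_smul_mem_Q₂ (X : Fin k → A.domain) (i : Fin k) (c : Fin k → 𝕜) :
    ((∑ j ∈ Finset.univ.erase i, c j • X j : A.domain) : E) ∈
      Q₂ (𝕜 := 𝕜) (fun j => (X j : E)) i := by
  rw [Submodule.coe_sum]
  exact Submodule.sum_mem _ fun j hj =>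
    Submodule.smul_mem _ _ (mem_Q₂ (fun j => (X j : E)) (Finset.ne_of_mem_erase hj))

theorem Q₁_isOrtho_Q₂ {x : Fin k → E} (hx : Orthonormal 𝕜 x) (i : Fin k) :
    Q₁ (𝕜 := 𝕜) x i ⟂ Q₂ (𝕜 := 𝕜) x i := by
  rw [Submodule.isOrtho_span]
  rintro _ rfl _ ⟨j, rfl⟩
  exact hx.2 j.2.symm

theorem norm_sum_smul_sq (hX : Orthonormal 𝕜 fun j => (X j : E)) (s : Finset (Fin k))
    (c : Fin k → 𝕜) : ‖((∑ j ∈ s, c j • X j : A.domain) : E)‖ ^ 2 = ∑ j ∈ s, ‖c j‖ ^ 2 := by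
  rw [Submodule.coe_sum]
  simp only [Submodule.coe_smul]
  rw [@norm_sq_eq_re_inner 𝕜, hX.inner_sum, map_sum]
  refine Finset.sum_congr rfl fun j _ => ?_
  rw [RCLike.conj_mul, ← RCLike.ofReal_pow, RCLike.ofReal_re]

/-- `gap` is at most the distance to each of the Ritz values other than the selected one. -/
theorem infDist_spec_compression_Q₂_le (hX : Orthonormal 𝕜 fun j => (X j : E))
    (hμ : ∀ l j, ⟪(X l : E), A (X j)⟫_𝕜 = if l = j then μ j else 0) {i j : Fin k} (hj : j ≠ i)
    (z : 𝕜) :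
    Metric.infDist z (spec (compression A (Q₂ (𝕜 := 𝕜) (fun j => (X j : E)) i))) ≤
      ‖z - μ j‖ := by
  set V := Q₂ (𝕜 := 𝕜) (fun j => (X j : E)) i
  have hmem : (X j : E) ∈ V := mem_Q₂ (fun j => (X j : E)) hj
  rw [← dist_eq_norm]
  -- `μ j` is an eigenvalue of the compression, with eigenvector `X j`. This inclusion suffices; the
  -- full spectrum need not be computed.
  refine Metric.infDist_le_dist_of_mem
    (mem_spec_of_apply_eq_smul (x := ⟨⟨X j, hmem⟩, (X j).2⟩) ?_ ?_)
  · intro h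
    exact hX.ne_zero j (congrArg Subtype.val h)
  · apply Subtype.ext
    change V.starProjection (A (X j)) = μ j • (X j : E)
    refine Submodule.eq_starProjection_of_mem_orthogonal (V.smul_mem _ hmem) ?_
    rw [Submodule.mem_orthogonal]
    intro y hy
    induction hy using Submodule.span_induction with
    | mem y hy =>
      obtain ⟨l, rfl⟩ := hy
      rw [inner_sub_right, inner_smul_right, hμ, orthonormal_iff_ite.mp hX]
      split_ifs <;> simp
    | zero => simp
    | add y z _ _ h h' => rw [inner_add_left, h, h', add_zero]
    | smul a y _ h => rw [inner_smul_left, h, mul_zero]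

/-- The block form of `A u = λ u` in the decomposition `u = u₁ + u₂ + w` along `Q₁`, `Q₂`, `Q₃`,
with `u₁` and `u₂` expanded in Ritz vectors. -/
theorem exists_eigenvector_decomposition
    (hA : ∀ x y : A.domain, ⟪A x, (y : E)⟫_𝕜 = ⟪(x : E), A y⟫_𝕜)
    (hX : Orthonormal 𝕜 fun j => (X j : E))
    (hμ : ∀ l j, ⟪(X l : E), A (X j)⟫_𝕜 = if l = j then μ j else 0)
    {U : Submodule 𝕜 E} [U.HasOrthogonalProjection] (hU : ∀ y, y ∈ U ↔ ∀ j, ⟪(X j : E), y⟫_𝕜 = 0)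
    (i : Fin k) {lam : 𝕜} {u : A.domain} (hu : (u : E) ≠ 0) (hAu : A u = lam • (u : E)) :
    ∃ (c : Fin k → 𝕜) (u₁ u₂ w : A.domain), u₁ = c i • X i ∧
      u₂ = ∑ j ∈ Finset.univ.erase i, c j • X j ∧
      ‖(u₁ : E) + u₂‖ ≤ ‖(u : E)‖ ∧ ‖(u₁ : E)‖ ≤ ‖(u : E)‖ ∧
      (∀ j, (lam - μ j) * c j = ⟪U.starProjection (A (X j)), (w : E)⟫_𝕜) ∧
      Metric.infDist lam (spec (compression A U)) * ‖(w : E)‖ ≤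
        ‖U.starProjection (A u₁) + U.starProjection (A u₂)‖ ∧
      Real.sin (lineAngle 𝕜 (u : E) (X i)) =
        √(‖(u₂ : E)‖ ^ 2 + ‖(w : E)‖ ^ 2) / ‖(u : E)‖ := by
  set c : Fin k → 𝕜 := fun j => ⟪(X j : E), (u : E)⟫_𝕜 with hc
  set v : A.domain := ∑ j, c j • X j with hv
  set u₁ : A.domain := c i • X i with hu₁
  set u₂ : A.domain := ∑ j ∈ Finset.univ.erase i, c j • X j with hu₂
  set w : A.domain := u - v with hw
  have hvs : u₁ + u₂ = v := Finset.add_sum_erase _ (fun j => c j • X j) (Finset.mem_univ i)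
  have hvcoe : (v : E) = ∑ j, c j • (X j : E) := by
    rw [hv, Submodule.coe_sum]
    rfl
  have hwU : (w : E) ∈ U := by
    rw [hU]
    intro j
    rw [hw, Submodule.coe_sub, inner_sub_right, hvcoe, hX.inner_right_fintype, sub_self]
  have hvw : ⟪(v : E), (w : E)⟫_𝕜 = 0 := by
    rw [hvcoe, sum_inner]
    exact Finset.sum_eq_zero fun j _ => by rw [inner_smul_left, (hU _).mp hwU, mul_zero]
  have huv : (u : E) = v + w := by
    rw [hw, Submodule.coe_sub, add_sub_cancel]
  have hPv : U.starProjection (v : E) = 0 := by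
    rw [U.starProjection_apply_eq_zero_iff, Submodule.mem_orthogonal']
    intro y hy
    rw [hvcoe, sum_inner]
    exact Finset.sum_eq_zero fun j _ => by rw [inner_smul_left, (hU _).mp hy, mul_zero]
  have hPw : U.starProjection (w : E) = w := Submodule.starProjection_eq_self_iff.mpr hwU
  have hnu : ‖(u : E)‖ ^ 2 = ‖(v : E)‖ ^ 2 + ‖(w : E)‖ ^ 2 := by
    rw [huv, sq, sq, sq, norm_add_sq_eq_norm_sq_add_norm_sq_of_inner_eq_zero _ _ hvw]
  have hnv : ‖(v : E)‖ ^ 2 = ‖c i‖ ^ 2 + ‖(u₂ : E)‖ ^ 2 := by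
    rw [norm_sum_smul_sq hX, norm_sum_smul_sq hX,
      Finset.add_sum_erase _ (fun j => ‖c j‖ ^ 2) (Finset.mem_univ i)]
  have hn1 : ‖(u₁ : E)‖ = ‖c i‖ := by
    rw [hu₁, Submodule.coe_smul, norm_smul, hX.1 i, mul_one]
  refine ⟨c, u₁, u₂, w, rfl, rfl, ?_, ?_, fun j => ?_, ?_, ?_⟩
  · rw [← Submodule.coe_add, hvs]
    refine le_of_sq_le_sq ?_ (norm_nonneg _)
    nlinarith [sq_nonneg ‖(w : E)‖]
  · refine le_of_sq_le_sq ?_ (norm_nonneg _)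
    rw [hn1]
    nlinarith [sq_nonneg ‖(w : E)‖, sq_nonneg ‖(u₂ : E)‖]
  · have h1 : lam * c j = ⟪A (X j), (u : E)⟫_𝕜 := by
      rw [hA, hAu, inner_smul_right]
    have h2 : ⟪A (X j), (v : E)⟫_𝕜 = μ j * c j := by
      rw [hvcoe, inner_sum]
      simp_rw [inner_smul_right, hA, hμ]
      simp [mul_comm]
    rw [sub_mul, h1, Submodule.inner_starProjection_left_eq_right, hPw, huv, inner_add_right, h2,
      add_sub_cancel_left]
  · refine (infDist_spec_compression_mul_norm_le hA U
      (conj_eq_of_apply_eq_smul hA hu hAu) hwU).trans_eq ?_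
    have hAw : A w = lam • (u : E) - (A u₁ + A u₂) := by
      rw [hw, ← hvs, LinearPMap.map_sub, LinearPMap.map_add, hAu]
    rw [← norm_neg, hAw, map_sub, map_smul, huv, map_add, map_add, hPv, hPw]
    congr 1
    module
  · rw [sin_lineAngle_of_norm_eq_one hu (hX.1 i)
      (add_nonneg (sq_nonneg ‖(u₂ : E)‖) (sq_nonneg ‖(w : E)‖))]
    linarith

/-- The vector `y = (lam - A₂₂) u₂` equals `A₂₃ w`. Testing it against itself moves `A` onto `y ∈
Q₂`, so the norm of `A₃₂` serves for that of its adjoint block. -/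
theorem norm_Q₂_component_le (hX : Orthonormal 𝕜 fun j => (X j : E))
    {U : Submodule 𝕜 E} [U.HasOrthogonalProjection] {i : Fin k} {lam : 𝕜} {c : Fin k → 𝕜}
    {u₂ w : A.domain} (hu₂ : u₂ = ∑ j ∈ Finset.univ.erase i, c j • X j)
    (hc : ∀ j, (lam - μ j) * c j = ⟪U.starProjection (A (X j)), (w : E)⟫_𝕜)
    {g : ℝ} (hg0 : 0 ≤ g) (hg : ∀ j, j ≠ i → g ≤ ‖lam - μ j‖) :
    g * ‖(u₂ : E)‖ ≤
      opNorm (block A U (Q₂ (𝕜 := 𝕜) (fun j => (X j : E)) i)) * ‖(w : E)‖ := by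
  set V := Q₂ (𝕜 := 𝕜) (fun j => (X j : E)) i
  have : FiniteDimensional 𝕜 V := FiniteDimensional.span_of_finite 𝕜 (Set.finite_range _)
  set d : Fin k → 𝕜 := fun j => (lam - μ j) * c j with hd
  set y : A.domain := ∑ j ∈ Finset.univ.erase i, d j • X j with hy
  have h1 : g * ‖(u₂ : E)‖ ≤ ‖(y : E)‖ := by
    refine le_of_sq_le_sq ?_ (norm_nonneg _)
    rw [mul_pow, hu₂, norm_sum_smul_sq hX, norm_sum_smul_sq hX, Finset.mul_sum]
    refine Finset.sum_le_sum fun j hj => ?_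
    rw [hd, norm_mul, mul_pow]
    gcongr
    exact hg j (Finset.ne_of_mem_erase hj)
  have hAy : A y = ∑ j ∈ Finset.univ.erase i, d j • A (X j) := by
    change A.toFun y = _
    rw [hy, map_sum]
    simp_rw [map_smul]
    rfl
  have h2 : ((‖(y : E)‖ ^ 2 : ℝ) : 𝕜) = ⟪U.starProjection (A y), (w : E)⟫_𝕜 := by
    rw [norm_sum_smul_sq hX, hAy, map_sum, sum_inner]
    push_cast
    refine Finset.sum_congr rfl fun j _ => ?_
    rw [map_smul, inner_smul_left, ← hc, ← RCLike.conj_mul]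
  have h3 : ‖(y : E)‖ ^ 2 ≤ opNorm (block A U V) * ‖(y : E)‖ * ‖(w : E)‖ := by
    have := norm_inner_le_norm (𝕜 := 𝕜) (U.starProjection (A y)) (w : E)
    rw [← h2, RCLike.norm_ofReal, abs_of_nonneg (sq_nonneg _)] at this
    refine this.trans ?_
    gcongr
    exact norm_starProjection_apply_le_opNorm_block A U V (Q₂_le_domain X i) y
      (sum_smul_mem_Q₂ X i d)
  refine h1.trans ?_
  rcases (norm_nonneg (y : E)).eq_or_lt with h0 | hpos
  · rw [← h0]
    exact mul_nonneg (opNorm_nonneg _) (norm_nonneg _)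
  · refine le_of_mul_le_mul_left ?_ hpos
    linarith

theorem norm_coeff_le {U : Submodule 𝕜 E} [U.HasOrthogonalProjection] {lam : 𝕜} {c : Fin k → 𝕜}
    {w : A.domain} (hc : ∀ j, (lam - μ j) * c j = ⟪U.starProjection (A (X j)), (w : E)⟫_𝕜)
    {j : Fin k} (hj : lam ≠ μ j) {r : ℝ} (hr : ‖U.starProjection (A (X j))‖ ≤ r) :
    ‖c j‖ ≤ r / ‖lam - μ j‖ * ‖(w : E)‖ := by
  have hpos : 0 < ‖lam - μ j‖ := norm_pos_iff.mpr (sub_ne_zero.mpr hj)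
  rw [div_mul_eq_mul_div, le_div_iff₀ hpos, mul_comm, ← norm_mul, hc]
  exact (norm_inner_le_norm _ _).trans (mul_le_mul_of_nonneg_right hr (norm_nonneg _))

/-- The Ritz vectors, as vectors of the domain. -/
theorem coe_sum_smul_eq_ritzVector (q : Fin k → A.domain) (Ω : Matrix (Fin k) (Fin k) 𝕜)
    (j : Fin k) : ((∑ l, Ω l j • q l : A.domain) : E) = ritzVector (fun l => (q l : E)) Ω j := by
  rw [Submodule.coe_sum]
  rfl

theorem orthonormal_ritzVector {q : Fin k → E} (hq : Orthonormal 𝕜 q)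
    {Ω : Matrix (Fin k) (Fin k) 𝕜} (hΩ : Ω ∈ Matrix.unitaryGroup (Fin k) 𝕜) :
    Orthonormal 𝕜 (ritzVector q Ω) := by
  rw [orthonormal_iff_ite]
  intro a b
  have h := congrFun (congrFun (Matrix.mem_unitaryGroup_iff'.mp hΩ) a) b
  rw [ritzVector, ritzVector, hq.inner_sum]
  rw [Matrix.mul_apply, Matrix.one_apply] at h
  rw [← h]
  rfl

theorem inner_ritzVector_apply {q : Fin k → A.domain} {Ω : Matrix (Fin k) (Fin k) 𝕜}
    (h : IsRayleighRitz A q Ω μ) (a b : Fin k) :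
    ⟪((∑ l, Ω l a • q l : A.domain) : E), A (∑ l, Ω l b • q l)⟫_𝕜 =
      if a = b then μ b else 0 := by
  have hΩ := Matrix.mem_unitaryGroup_iff'.mp h.unitary
  rw [Matrix.star_eq_conjTranspose] at hΩ
  have hM : Ω.conjTranspose * ritzMatrix A q * Ω = Matrix.diagonal μ := by
    rw [h.decomposition]
    calc _ = (Ω.conjTranspose * Ω) * Matrix.diagonal μ * (Ω.conjTranspose * Ω) := by
          simp only [Matrix.mul_assoc]
      _ = _ := by rw [hΩ, Matrix.one_mul, Matrix.mul_one]
  have hab := congrFun (congrFun hM a) b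
  have hA : A (∑ l, Ω l b • q l) = ∑ l, Ω l b • A (q l) := by
    change A.toFun _ = _
    rw [map_sum]
    simp_rw [map_smul]
    rfl
  rw [Matrix.diagonal_apply] at hab
  rw [Submodule.coe_sum, hA, inner_sum]
  rw [show (if a = b then μ b else 0) = if a = b then μ a else 0 by split_ifs with e <;> simp [e],
    ← hab, Matrix.mul_apply]
  refine Finset.sum_congr rfl fun m _ => ?_
  rw [inner_smul_right, sum_inner, Matrix.mul_apply, mul_comm]
  congr 1
  refine Finset.sum_congr rfl fun l _ => ?_
  rw [Submodule.coe_smul, inner_smul_left]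
  rfl

/-- `Ω Ω* = 1` inverts the change of basis, so the Ritz vectors span the whole trial space. -/
theorem eq_sum_ritzVector (q : Fin k → E) {Ω : Matrix (Fin k) (Fin k) 𝕜}
    (hΩ : Ω ∈ Matrix.unitaryGroup (Fin k) 𝕜) (l : Fin k) :
    q l = ∑ j, (starRingEnd 𝕜) (Ω l j) • ritzVector q Ω j := by
  simp_rw [ritzVector, Finset.smul_sum, smul_smul]
  rw [Finset.sum_comm]
  simp_rw [← Finset.sum_smul]
  have h := Matrix.mem_unitaryGroup_iff.mp hΩ
  have h' : ∀ m, ∑ j, (starRingEnd 𝕜) (Ω l j) * Ω m j = if m = l then 1 else 0 := fun m => by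
    have := congrFun (congrFun h m) l
    rw [Matrix.mul_apply, Matrix.one_apply] at this
    rw [← this]
    exact Finset.sum_congr rfl fun j _ => mul_comm _ _
  simp [h']

theorem mem_Q₃_iff (q : Fin k → E) {Ω : Matrix (Fin k) (Fin k) 𝕜}
    (hΩ : Ω ∈ Matrix.unitaryGroup (Fin k) 𝕜) (y : E) :
    y ∈ Q₃ (𝕜 := 𝕜) q ↔ ∀ j, ⟪ritzVector q Ω j, y⟫_𝕜 = 0 := by
  rw [Submodule.mem_orthogonal]
  constructor
  · intro h j
    exact h _ (Submodule.sum_mem _ fun l _ =>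
      Submodule.smul_mem _ _ (Submodule.subset_span ⟨l, rfl⟩))
  · intro h z hz
    induction hz using Submodule.span_induction with
    | mem z hz =>
      obtain ⟨l, rfl⟩ := hz
      rw [eq_sum_ritzVector q hΩ l, sum_inner]
      exact Finset.sum_eq_zero fun j _ => by rw [inner_smul_left, h, mul_zero]
    | zero => simp
    | add a b _ _ ha hb => rw [inner_add_left, ha, hb, add_zero]
    | smul a b _ hb => rw [inner_smul_left, hb, mul_zero]

end Ritz

end RitzHilbert

/-! ### The three bounds -/

open RitzHilbert in
theorem theorem5 {𝕜 : Type*} [RCLike 𝕜] {H : Type*} [NormedAddCommGroup H]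
    [InnerProductSpace 𝕜 H] [CompleteSpace H]
    (A : H →ₗ.[𝕜] H) (hdense : Dense (A.domain : Set H)) (hA : IsSelfAdjoint A)
    (k : ℕ) (hk : 2 ≤ k) (q : Fin k → A.domain)
    (Ω : Matrix (Fin k) (Fin k) 𝕜) (μ : Fin k → 𝕜) (hRR : IsRayleighRitz A q Ω μ)
    (i : Fin k)
    (lam : 𝕜) (u : A.domain) (hu : (u : H) ≠ 0) (hAu : A u = lam • (u : H))
    (R R₁ R₂ gap Gap sinθ : ℝ) (r : Fin k → ℝ)
    (hR : R = normR A (fun j => (q j : H)) Ω i)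
    (hR₁ : R₁ = normR₁ A (fun j => (q j : H)) Ω i)
    (hR₂ : R₂ = normR₂ A (fun j => (q j : H)) Ω i)
    (hr : ∀ j, r j = normr A (fun j => (q j : H)) Ω i j)
    (hgap : gap = smallGap A (fun j => (q j : H)) Ω i lam)
    (hGap : Gap = bigGap A (fun j => (q j : H)) lam)
    (hsin : sinθ = Real.sin (lineAngle 𝕜 (u : H) (ritzVector (fun j => (q j : H)) Ω i))) :
    (0 < gap → 0 < Gap →
      sinθ ≤ R / Gap * √(1 + R₂ ^ 2 / gap ^ 2) ∧
      R / Gap * √(1 + R₂ ^ 2 / gap ^ 2) ≤ R / Gap * (1 + R₂ / gap)) ∧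
    (0 < gap → R₂ ^ 2 / gap < Gap →
      sinθ ≤ R₁ / (Gap - R₂ ^ 2 / gap) * √(1 + R₂ ^ 2 / gap ^ 2)) ∧
    ((∀ j, j ≠ i → lam ≠ μ j) →
      ∑ j ∈ Finset.univ.erase i, r j ^ 2 / ‖lam - μ j‖ < Gap →
      sinθ ≤ R₁ / (Gap - ∑ j ∈ Finset.univ.erase i, r j ^ 2 / ‖lam - μ j‖) *
        √(1 + (∑ j ∈ Finset.univ.erase i, r j / ‖lam - μ j‖) ^ 2)) := by
  have hsymm : ∀ x y : A.domain, inner 𝕜 (A x) (y : H) = inner 𝕜 (x : H) (A y) := by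
    have := A.adjoint_isFormalAdjoint hdense
    rw [LinearPMap.isSelfAdjoint_def.mp hA] at this
    exact this
  set X : Fin k → A.domain := fun j => ∑ l, Ω l j • q l with hXdef
  have hx : ritzVector (fun j => (q j : H)) Ω = fun j => (X j : H) :=
    funext fun j => (coe_sum_smul_eq_ritzVector q Ω j).symm
  have hX : Orthonormal 𝕜 fun j => (X j : H) :=
    hx ▸ orthonormal_ritzVector hRR.orthonormal hRR.unitary
  have hμ : ∀ l j, inner 𝕜 (X l : H) (A (X j)) = if l = j then μ j else 0 :=
    inner_ritzVector_apply hRR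
  set U := Q₃ (𝕜 := 𝕜) fun j => (q j : H) with hUdef
  have hU : ∀ y, y ∈ U ↔ ∀ j, inner 𝕜 (X j : H) y = 0 := fun y => by
    rw [hUdef, mem_Q₃_iff _ hRR.unitary, hx]
  simp only [normR, hx] at hR
  simp only [normR₁, hx] at hR₁
  simp only [normR₂, hx] at hR₂
  simp only [normr, hx] at hr
  have hQ₂ : ∀ y z : Fin k → H, y = z →
      Metric.infDist lam (spec (compression A (Q₂ (𝕜 := 𝕜) y i))) =
        Metric.infDist lam (spec (compression A (Q₂ (𝕜 := 𝕜) z i))) := by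
    rintro y _ rfl
    rfl
  rw [smallGap, hQ₂ _ _ hx] at hgap
  rw [bigGap] at hGap
  rw [hx] at hsin
  obtain ⟨c, u₁, u₂, w, hu₁, hu₂, hu₁₂N, hu₁N, hc, hw, hs⟩ :=
    exists_eigenvector_decomposition hsymm hX hμ hU i hu hAu
  rw [hs] at hsin
  rw [← hGap] at hw
  set V₁ := Q₁ (𝕜 := 𝕜) (fun j => (X j : H)) i
  set V₂ := Q₂ (𝕜 := 𝕜) (fun j => (X j : H)) i
  have : FiniteDimensional 𝕜 V₂ := FiniteDimensional.span_of_finite 𝕜 (Set.finite_range _)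
  have hV₁ : V₁ ≤ A.domain := Q₁_le_domain X i
  have hV₂ : V₂ ≤ A.domain := Q₂_le_domain X i
  have hu₁V : (u₁ : H) ∈ V₁ := by
    rw [hu₁]
    exact V₁.smul_mem _ (Submodule.mem_span_singleton_self _)
  have hu₂V : (u₂ : H) ∈ V₂ := hu₂ ▸ sum_smul_mem_Q₂ X i c
  have hR0 : 0 ≤ R := hR ▸ opNorm_nonneg _
  have hR₁0 : 0 ≤ R₁ := hR₁ ▸ opNorm_nonneg _
  have hR₂0 : 0 ≤ R₂ := hR₂ ▸ opNorm_nonneg _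
  have hN : 0 < ‖(u : H)‖ := norm_pos_iff.mpr hu
  have hPR : ‖U.starProjection (A u₁) + U.starProjection (A u₂)‖ ≤ R * ‖(u : H)‖ := by
    refine (norm_starProjection_apply_add_le_opNorm_block_add A U V₁ V₂ hV₁ hV₂
      (Q₁_isOrtho_Q₂ hX i) u₁ u₂ hu₁V hu₂V).trans ?_
    rw [← hR]
    gcongr
  have hPR₁ : ‖U.starProjection (A u₁)‖ ≤ R₁ * ‖(u : H)‖ := by
    refine (norm_starProjection_apply_le_opNorm_block A U V₁ hV₁ u₁ hu₁V).trans ?_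
    rw [← hR₁]
    gcongr
  have hPR₂ : ‖U.starProjection (A u₂)‖ ≤ R₂ * ‖(u₂ : H)‖ :=
    hR₂ ▸ norm_starProjection_apply_le_opNorm_block A U V₂ hV₂ u₂ hu₂V
  have hPr : ∀ j, j ≠ i → ‖U.starProjection (A (X j))‖ ≤ r j := fun j hj => by
    have := norm_starProjection_apply_le_opNorm_precomp A U V₂ (Submodule.span 𝕜 {(X j : H)}) hV₂
      (X j) (mem_Q₂ (fun j => (X j : H)) hj) (Submodule.mem_span_singleton_self _)
    rwa [hX.1 j, mul_one, ← hr j] at this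
  have ht : 0 < gap → ‖(u₂ : H)‖ ≤ R₂ / gap * ‖(w : H)‖ := fun hg => by
    rw [div_mul_eq_mul_div, le_div_iff₀ hg, mul_comm, hR₂]
    exact norm_Q₂_component_le hX hu₂ hc hg.le
      fun j hj => hgap ▸ infDist_spec_compression_Q₂_le hX hμ hj lam
  refine ⟨fun hg hG => ⟨?_, ?_⟩, fun hg hG => ?_, fun hne hG => ?_⟩
  · rw [hsin, ← div_pow]
    refine sqrt_add_sq_div_le (norm_nonneg _) (norm_nonneg _) hN ?_ (ht hg)
    rw [div_mul_eq_mul_div, le_div_iff₀ hG, mul_comm]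
    exact hw.trans hPR
  · rw [← div_pow]
    have : 0 ≤ R₂ / gap := by positivity
    gcongr
    rw [Real.sqrt_le_iff]
    constructor <;> nlinarith
  · rw [hsin, ← div_pow]
    refine sqrt_add_sq_div_le (norm_nonneg _) (norm_nonneg _) hN ?_ (ht hg)
    rw [div_mul_eq_mul_div, le_div_iff₀ (sub_pos.mpr hG), mul_sub]
    -- The coupling between `Q₂` and `Q₃` is used twice, from `w` to `u₂` and back, hence the square
    -- in the term absorbed by `Gap * ‖w‖`.
    have h1 : R₂ * ‖(u₂ : H)‖ ≤ R₂ ^ 2 / gap * ‖(w : H)‖ := by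
      calc _ ≤ R₂ * (R₂ / gap * ‖(w : H)‖) := by
            gcongr
            exact ht hg
        _ = _ := by ring
    linarith [hw.trans (norm_add_le _ _)]
  · have hcr : ∀ j ∈ Finset.univ.erase i, ‖c j‖ ≤ r j / ‖lam - μ j‖ * ‖(w : H)‖ := fun j hj =>
      norm_coeff_le hc (hne j (Finset.ne_of_mem_erase hj)) (hPr j (Finset.ne_of_mem_erase hj))
    rw [hsin]
    refine sqrt_add_sq_div_le (norm_nonneg _) (norm_nonneg _) hN ?_ ?_
    · rw [div_mul_eq_mul_div, le_div_iff₀ (sub_pos.mpr hG), mul_sub]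
      have hAu₂ : A u₂ = ∑ j ∈ Finset.univ.erase i, c j • A (X j) := by
        change A.toFun u₂ = _
        rw [hu₂, map_sum]
        simp_rw [map_smul]
        rfl
      have h1 : ‖U.starProjection (A u₂)‖ ≤
          (∑ j ∈ Finset.univ.erase i, r j ^ 2 / ‖lam - μ j‖) * ‖(w : H)‖ := by
        rw [hAu₂, map_sum, Finset.sum_mul]
        refine norm_sum_le_of_le _ fun j hj => ?_
        rw [map_smul, norm_smul]
        have hrj := hPr j (Finset.ne_of_mem_erase hj)
        calc _ ≤ r j / ‖lam - μ j‖ * ‖(w : H)‖ * r j :=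
              mul_le_mul (hcr j hj) hrj (norm_nonneg _) ((norm_nonneg _).trans (hcr j hj))
          _ = _ := by ring
      linarith [hw.trans (norm_add_le _ _)]
    -- The triangle inequality, rather than Pythagoras, yields the square of a sum under the root.
    · rw [hu₂, Submodule.coe_sum, Finset.sum_mul]
      refine norm_sum_le_of_le _ fun j hj => ?_
      rw [Submodule.coe_smul, norm_smul, hX.1 j, mul_one]
      exact hcr j hj
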